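/- Let $M$ be a free abelian group of finite rank, let $V = M\otimes_{\mathbb Z}\mathbb R$ be its ambient real vector space, and regard $M$ as a subset of $V$, whose elements are called the integer points of $V$. For $P\subset V$ put $P(\mathbb Z)=P\cap M$, and for $X\subset M$ let $\mathrm{co}(X)$ denote the convex hull of $X$ in $V$. A polyhedron in $V$ is the solution set of a finite system of inequalities $p(v)\le a$ with $p$ a real linear functional on $V$ and $a\in\mathbb R$. It is rational if it is the solution set of such a finite system with every $p$ in $M^*=\mathrm{Hom}(M,\mathbb Z)$ (extended linearly to $V$) and every $a$ in $\mathbb Z$. It is integer if it is rational and each of its non-empty faces contains an integer point, where a face of $P$ is the set of points of $P$ at which some linear functional on $V$ attains its maximum over $P$ (so $P$ is a face of itself). A subset $X\subset M$ is pseudo-convex if $X=\mathrm{co}(X)(\mathbb Z)$ and $\mathrm{co}(X)$ is a polyhedron. **Proposition 1.** For every subset $X\subset M$ the following assertions are equivalent: a) $X$ is pseudo-convex; b) $X=P(\mathbb Z)$ for some integer polyhedron $P\subset V$; c) $X$ is the set of integer solutions of a finite system of linear inequalities with integer coefficients, that is, $X=\{m\in M : p_i(m)\le a_i,\ i=1,\dots,k\}$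 for some $k\ge 0$, $p_1,\dots,p_k\in M^*$ and $a_1,\dots,a_k\in\mathbb Z$. -/

import Mathlib

open scoped TensorProduct

namespace DiscreteConvexity

/-- The ambient real vector space `V` of the group `M`, obtained by extending scalars from the
integers to the reals. -/
abbrev Ambient (M : Type*) [AddCommGroup M] : Type _ := ℝ ⊗[ℤ] M

/-- The canonical map from `M` to its ambient space, sending `m` to `1 ⊗ m`
(injective when `M` is free). -/
noncomputable def toAmbient (M : Type*) [AddCommGroup M] : M →ₗ[ℤ] Ambient M :=
  TensorProduct.mk ℤ ℝ M 1

/-- The set `P(ℤ)` of integer points of a subset `P` of the ambient space, viewed in `M`. -/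
def integerPoints {M : Type*} [AddCommGroup M] (P : Set (Ambient M)) : Set M :=
  {m | toAmbient M m ∈ P}

/-- The real linear functional on the ambient space that extends a homomorphism from `M` to the
integers: it sends `r ⊗ m` to `r * p m`. -/
noncomputable def extendFunctional {M : Type*} [AddCommGroup M] (p : M →ₗ[ℤ] ℤ) :
    Ambient M →ₗ[ℝ] ℝ :=
  (TensorProduct.AlgebraTensorModule.rid ℤ ℝ ℝ).toLinearMap ∘ₗ p.baseChange ℝ

/-- The convex hull, in the ambient space, of a set of elements of `M`. -/
noncomputable def hull {M : Type*} [AddCommGroup M] (X : Set M) : Set (Ambient M) :=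
  convexHull ℝ (toAmbient M '' X)

/-- A polyhedron: the solution set of a finite system of real linear inequalities `p v ≤ a`. -/
def IsPolyhedron {V : Type*} [AddCommGroup V] [Module ℝ V] (P : Set V) : Prop :=
  ∃ S : Finset ((V →ₗ[ℝ] ℝ) × ℝ), P = {v | ∀ s ∈ S, s.1 v ≤ s.2}

/-- A rational polyhedron: the solution set in the ambient space of a finite system of
inequalities `p v ≤ a`, where `p` is a homomorphism from `M` to the integers and `a` is an
integer. -/
def IsRationalPolyhedron {M : Type*} [AddCommGroup M] (P : Set (Ambient M)) : Prop :=
  ∃ S : Finset ((M →ₗ[ℤ] ℤ) × ℤ), P = {v | ∀ s ∈ S, extendFunctional s.1 v ≤ (s.2 : ℝ)}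

/-- `F` is a face of `P`: the set of points of `P` at which some linear functional attains its
maximum over `P`. The zero functional gives `P` itself; an unbounded functional gives the empty
set. -/
def IsFace {V : Type*} [AddCommGroup V] [Module ℝ V] (P F : Set V) : Prop :=
  ∃ p : V →ₗ[ℝ] ℝ, F = {v | v ∈ P ∧ ∀ w ∈ P, p w ≤ p v}

/-- An integer polyhedron: a rational polyhedron each of whose nonempty faces contains an integer
point. -/
def IsIntegerPolyhedron {M : Type*} [AddCommGroup M] (P : Set (Ambient M)) : Prop :=
  IsRationalPolyhedron P ∧
    ∀ F : Set (Ambient M), IsFace P F → F.Nonempty → (integerPoints F).Nonempty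

/-- `X` is pseudo-convex: it is the set of integer points of its convex hull, and this convex hull
is a polyhedron. -/
def IsPseudoConvex {M : Type*} [AddCommGroup M] (X : Set M) : Prop :=
  X = integerPoints (hull X) ∧ IsPolyhedron (hull X)

/-- `X` is the set of solutions in `M` of a finite system of linear inequalities `p m ≤ a` with
integer coefficients. -/
def IsIntegerSolutionSet {M : Type*} [AddCommGroup M] (X : Set M) : Prop :=
  ∃ S : Finset ((M →ₗ[ℤ] ℤ) × ℤ), X = {m | ∀ s ∈ S, s.1 m ≤ s.2}

end DiscreteConvexity

/-! The integer solution sets c) are the hub. For c) ⇒ a), b), homogenize: the solutions become the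
height-one slice of a cone in `M × ℤ`, whose integer points form a finitely generated monoid
(`exists_finset_closure_eq`). A solution is a sum of generators of height 0 or 1, and those of
height 0 translate the solution set into itself, so the convex hull is the height-one slice of the
real cone on these generators. Fourier–Motzkin elimination gives this cone integer inequalities, so
the hull is rational. Its nonempty faces meet `X`, since a maximum over a convex hull is attained on
the generating set.

For a) ⇒ c), the given inequalities may have irrational coefficients. Take an irredundant subsystem
relative to the span of `X × {1}`. Each inequality defines a facet, and the points of `X` on it span
the kernel of the homogenized functional in that span; hence the functional is there a positive
multiple of an integer one (`exists_functional_of_irredundant`). Integer equations for the span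
complete the system. Finally b) ⇒ c) is restriction to `M`. -/

namespace DiscreteConvexity

/-! ### Integer cones: elimination, separation, Gordan's lemma -/

section Cone

variable {N W : Type*} [AddCommGroup N] [AddCommGroup W] [Module ℝ W]
  {e : N →+ W} {E : (N →ₗ[ℤ] ℤ) →ₗ[ℤ] (W →ₗ[ℝ] ℝ)}

/-- Fourier–Motzkin elimination: adding a ray spanned by an integer vector to a cone cut out by
integer functionals gives a cone of the same kind. -/
theorem exists_finset_cone_add_ray (hE : ∀ q n, E q (e n) = q n)
    (Q : Finset (N →ₗ[ℤ] ℤ)) (r : N) :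
    ∃ Q' : Finset (N →ₗ[ℤ] ℤ), ∀ w : W,
      (∃ t : ℝ, 0 ≤ t ∧ ∀ q ∈ Q, E q (w - t • e r) ≤ 0) ↔ ∀ q ∈ Q', E q w ≤ 0 := by
  classical
  -- Positive `q r` bounds `t` below, negative `q r` bounds it above. Each combination vanishes at
  -- `r` and says that a lower bound is at most an upper one.
  refine ⟨{q ∈ Q | q r ≤ 0} ∪
    Finset.image₂ (fun q q' ↦ q r • q' - q' r • q) {q ∈ Q | 0 < q r} {q ∈ Q | q r < 0},
    fun w ↦ ?_⟩
  have key (t : ℝ) (q) : E q (w - t • e r) = E q w - t * q r := by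
    rw [map_sub, map_smul, hE, smul_eq_mul]
  have comb (q q' : N →ₗ[ℤ] ℤ) :
      E (q r • q' - q' r • q) w = q r * E q' w - q' r * E q w := by
    simp
  simp only [key]
  constructor
  · rintro ⟨t, ht, h⟩ q hq
    rw [Finset.mem_union] at hq
    rcases hq with hq | hq
    · obtain ⟨hq, hr⟩ := Finset.mem_filter.1 hq
      have hr : (q r : ℝ) ≤ 0 := by exact_mod_cast hr
      nlinarith [h q hq]
    · obtain ⟨q, hq₁, q', hq', rfl⟩ := Finset.mem_image₂.1 hq
      obtain ⟨hq, hr⟩ := Finset.mem_filter.1 hq₁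
      obtain ⟨hq', hr'⟩ := Finset.mem_filter.1 hq'
      have hr : 0 < (q r : ℝ) := by exact_mod_cast hr
      have hr' : (q' r : ℝ) < 0 := by exact_mod_cast hr'
      rw [comb]
      nlinarith [h q hq, h q' hq']
  · intro h
    -- The witness `t` is the largest lower bound, including `0 ≤ t`.
    let A : Finset ℝ := insert 0 ({q ∈ Q | 0 < q r}.image fun q ↦ E q w / q r)
    have hA : A.Nonempty := Finset.insert_nonempty _ _
    refine ⟨A.max' hA, A.le_max' _ (Finset.mem_insert_self _ _), fun q hq ↦ ?_⟩
    rcases lt_trichotomy (q r) 0 with hr | hr | hr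
    · have hr' : (q r : ℝ) < 0 := by exact_mod_cast hr
      have : A.max' hA ≤ E q w / q r := by
        refine A.max'_le hA _ fun a ha ↦ ?_
        rcases Finset.mem_insert.1 ha with rfl | ha
        · exact div_nonneg_of_nonpos
            (h q (Finset.mem_union_left _ (Finset.mem_filter.2 ⟨hq, hr.le⟩))) hr'.le
        · obtain ⟨q', hq', rfl⟩ := Finset.mem_image.1 ha
          have hr₂ : 0 < (q' r : ℝ) := by exact_mod_cast (Finset.mem_filter.1 hq').2
          have := h _ (Finset.mem_union_right _ (Finset.mem_image₂_of_mem hq'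
            (Finset.mem_filter.2 ⟨hq, hr⟩)))
          rw [comb] at this
          rw [div_le_iff₀ hr₂, div_mul_eq_mul_div, le_div_iff_of_neg hr']
          linarith
      rw [le_div_iff_of_neg hr'] at this
      linarith
    · have := h q (Finset.mem_union_left _ (Finset.mem_filter.2 ⟨hq, hr.le⟩))
      simpa [hr] using this
    · have hr' : 0 < (q r : ℝ) := by exact_mod_cast hr
      have : E q w / q r ≤ A.max' hA := A.le_max' _ (Finset.mem_insert_of_mem
        (Finset.mem_image_of_mem (fun q : N →ₗ[ℤ] ℤ ↦ E q w / q r)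
          (Finset.mem_filter.2 ⟨hq, hr⟩)))
      rw [div_le_iff₀ hr'] at this
      linarith

/-- A cone generated by finitely many integer vectors is cut out by finitely many integer
functionals, provided that the zero cone is. -/
theorem exists_finset_cone_iff (hE : ∀ q n, E q (e n) = q n)
    (h0 : ∃ Q : Finset (N →ₗ[ℤ] ℤ), ∀ w : W, (∀ q ∈ Q, E q w ≤ 0) → w = 0) (G : Finset N) :
    ∃ Q : Finset (N →ₗ[ℤ] ℤ), ∀ w : W,
      (∃ c : N → ℝ, (∀ g ∈ G, 0 ≤ c g) ∧ w = ∑ g ∈ G, c g • e g) ↔ ∀ q ∈ Q, E q w ≤ 0 := by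
  classical
  induction G using Finset.induction_on with
  | empty =>
    obtain ⟨Q, hQ⟩ := h0
    refine ⟨Q, fun w ↦ ⟨?_, fun h ↦ ⟨0, by simp, by simpa using hQ w h⟩⟩⟩
    rintro ⟨c, -, rfl⟩ q -
    simp
  | insert r G hr ih =>
    obtain ⟨Q, hQ⟩ := ih
    obtain ⟨Q', hQ'⟩ := exists_finset_cone_add_ray hE Q r
    refine ⟨Q', fun w ↦ ?_⟩
    rw [← hQ' w]
    simp only [← hQ]
    constructor
    · rintro ⟨c, hc, rfl⟩
      exact ⟨c r, hc r (Finset.mem_insert_self _ _), c,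
        fun g hg ↦ hc g (Finset.mem_insert_of_mem hg), by simp [Finset.sum_insert hr]⟩
    · rintro ⟨t, ht, c, hc, hw⟩
      have hne : ∀ g ∈ G, g ≠ r := fun g hg h ↦ hr (h ▸ hg)
      refine ⟨Function.update c r t, fun g hg ↦ ?_, ?_⟩
      · rcases Finset.mem_insert.1 hg with rfl | hg
        · simpa using ht
        · simpa [Function.update_of_ne (hne g hg)] using hc g hg
      · rw [Finset.sum_insert hr, Function.update_self, Finset.sum_congr rfl
          fun g hg ↦ by rw [Function.update_of_ne (hne g hg)], ← hw]
        abel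

/-- An integer vector outside the real span of a set of integer vectors can be separated from
this set by an integer functional. -/
theorem exists_functional_neg_of_notMem_span [Module.Finite ℤ N] (S : Set N) {z : N}
    (hz : e z ∉ Submodule.span ℝ (e '' S)) :
    ∃ q : N →ₗ[ℤ] ℤ, (∀ s ∈ S, q s = 0) ∧ q z < 0 := by
  -- Modulo torsion this quotient is free, so a nonzero class has a nonzero coordinate; a torsion
  -- class would put `e z` in the real span.
  let A := N ⧸ Submodule.span ℤ S
  let T := Submodule.torsion ℤ A
  let π : N →ₗ[ℤ] A ⧸ T := T.mkQ ∘ₗ (Submodule.span ℤ S).mkQ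
  have hπ : π z ≠ 0 := by
    intro h
    have h : (Submodule.span ℤ S).mkQ z ∈ T :=
      (Submodule.Quotient.mk_eq_zero T).1 h
    obtain ⟨n, hn⟩ := (Submodule.mem_torsion_iff _).1 h
    have hn0 : (n : ℤ) ≠ 0 := nonZeroDivisors.coe_ne_zero n
    have hn : (n : ℤ) • z ∈ Submodule.span ℤ S := by
      rw [← Submodule.Quotient.mk_eq_zero]
      exact hn
    have h1 : e ((n : ℤ) • z) ∈ Submodule.span ℝ (e '' S) := by
      refine Submodule.span_induction
        (p := fun x _ ↦ e x ∈ Submodule.span ℝ (e '' S)) ?_ ?_ ?_ ?_ hn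
      · exact fun x hx ↦ Submodule.subset_span ⟨x, hx, rfl⟩
      · simp
      · intro x y _ _ hx hy
        rw [map_add]
        exact add_mem hx hy
      · intro a x _ hx
        rw [map_zsmul]
        exact zsmul_mem hx a
    rw [map_zsmul, ← Int.cast_smul_eq_zsmul ℝ] at h1
    exact hz ((Submodule.smul_mem_iff _ (by exact_mod_cast hn0)).1 h1)
  let b := Module.Free.chooseBasis ℤ (A ⧸ T)
  obtain ⟨i, hi⟩ : ∃ i, b.repr (π z) i ≠ 0 := by
    by_contra! h
    exact hπ (b.repr.map_eq_zero_iff.1 (Finsupp.ext h))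
  have hS : ∀ s ∈ S, π s = 0 := fun s hs ↦ by
    have : (Submodule.span ℤ S).mkQ s = 0 :=
      (Submodule.Quotient.mk_eq_zero _).2 (Submodule.subset_span hs)
    simp only [π, LinearMap.comp_apply, this, map_zero]
  rcases lt_or_gt_of_ne hi with hi | hi
  · exact ⟨b.coord i ∘ₗ π, fun s hs ↦ by simp [hS s hs], by simpa using hi⟩
  · exact ⟨-(b.coord i ∘ₗ π), fun s hs ↦ by simp [hS s hs], by simpa using hi⟩

/-- The integer points of the real span of a set of integer vectors are cut out by finitely many
integer functionals. -/
theorem exists_finset_mem_span [Module.Free ℤ N] [Module.Finite ℤ N] (S : Set N) :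
    ∃ Q : Finset (N →ₗ[ℤ] ℤ), (∀ q ∈ Q, ∀ s ∈ S, q s = 0) ∧
      ∀ z, (∀ q ∈ Q, q z = 0) → e z ∈ Submodule.span ℝ (e '' S) := by
  let D : Submodule ℤ (N →ₗ[ℤ] ℤ) :=
    { carrier := {q | ∀ s ∈ S, q s = 0}
      add_mem' := fun ha hb s hs ↦ by simp [ha s hs, hb s hs]
      zero_mem' := fun s _ ↦ rfl
      smul_mem' := fun c q hq s hs ↦ by simp [hq s hs] }
  obtain ⟨Q, hQ⟩ : D.FG := IsNoetherian.noetherian D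
  refine ⟨Q, fun q hq ↦ ?_, fun z hz ↦ ?_⟩
  · have : q ∈ D := hQ ▸ Submodule.subset_span hq
    exact this
  · by_contra h
    obtain ⟨q, hq, hqz⟩ := exists_functional_neg_of_notMem_span S h
    have hqD : q ∈ Submodule.span ℤ (Q : Set (N →ₗ[ℤ] ℤ)) := hQ ▸ hq
    have : q z = 0 := by
      refine Submodule.span_induction (p := fun q _ ↦ q z = 0) hz rfl ?_ ?_ hqD
      · intro x y _ _ hx hy
        simp [hx, hy]
      · intro a x _ hx
        simp [hx]
    exact hqz.ne this

/-- A real functional on the span of a set of integer vectors whose kernel is spanned by members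
of this set is proportional to an integer functional. -/
theorem exists_functional_eq_mul [Module.Finite ℤ N] (hE : ∀ q n, E q (e n) = q n) (S : Set N)
    (φ : W →ₗ[ℝ] ℝ)
    (hφ : ∀ w ∈ Submodule.span ℝ (e '' S), φ w = 0 →
      w ∈ Submodule.span ℝ (e '' {s ∈ S | φ (e s) = 0}))
    {z : N} (hz : z ∈ S) (hzφ : φ (e z) < 0) :
    ∃ (q : N →ₗ[ℤ] ℤ) (c : ℝ), 0 < c ∧
      ∀ w ∈ Submodule.span ℝ (e '' S), φ w = c * E q w := by
  have vanish (ψ : W →ₗ[ℝ] ℝ) (h : ∀ s ∈ {s ∈ S | φ (e s) = 0}, ψ (e s) = 0) :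
      ∀ w ∈ Submodule.span ℝ (e '' {s ∈ S | φ (e s) = 0}), ψ w = 0 := by
    intro w hw
    have : Submodule.span ℝ (e '' {s ∈ S | φ (e s) = 0}) ≤ LinearMap.ker ψ := by
      rw [Submodule.span_le]
      rintro _ ⟨s, hs, rfl⟩
      exact h s hs
    exact this hw
  obtain ⟨q, hq, hqz⟩ := exists_functional_neg_of_notMem_span (e := e) {s ∈ S | φ (e s) = 0}
    (z := z) fun h ↦ hzφ.ne (vanish φ (fun s hs ↦ hs.2) _ h)
  have hqz' : (q z : ℝ) < 0 := by exact_mod_cast hqz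
  refine ⟨q, φ (e z) / q z, div_pos_of_neg_of_neg hzφ hqz', fun w hw ↦ ?_⟩
  -- Correcting `w` by a multiple of `e z` lands in the kernel of `φ`, where `E q` vanishes too.
  have h1 : φ (w - (φ w / φ (e z)) • e z) = 0 := by
    rw [map_sub, map_smul, smul_eq_mul, div_mul_cancel₀ _ hzφ.ne, sub_self]
  have h2 := vanish (E q) (fun s hs ↦ by rw [hE, hq s hs, Int.cast_zero]) _
    (hφ _ (sub_mem hw (Submodule.smul_mem _ _ (Submodule.subset_span ⟨z, hz, rfl⟩))) h1)
  rw [map_sub, map_smul, smul_eq_mul, hE, sub_eq_zero] at h2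
  have := hzφ.ne
  have := hqz'.ne
  rw [h2]
  field_simp

/-- **Gordan's lemma**: the integer points of a cone cut out by finitely many integer functionals
form a finitely generated monoid. -/
theorem exists_finset_closure_eq [Module.Finite ℤ N] (Q : Finset (N →ₗ[ℤ] ℤ)) :
    ∃ G : Finset N, ∀ z, z ∈ AddSubmonoid.closure (G : Set N) ↔ ∀ q ∈ Q, q z ≤ 0 := by
  have : AddGroup.FG N := Module.Finite.iff_addGroup_fg.1 ‹_›
  obtain ⟨n, h, hh⟩ := AddSubmonoid.fg_iff_exists_fin_addMonoidHom.1
    (AddMonoid.FG.fg_top (M := N))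
  -- Natural slack variables turn the inequalities into equations over a finitely generated free
  -- commutative monoid, whose solution monoid is finitely generated.
  let f : (Fin n → ℕ) × (Q → ℕ) →+ (Q → ℤ) :=
    { toFun := fun x q ↦ q.1 (h x.1) + x.2 q
      map_zero' := by ext; simp
      map_add' := fun x y ↦ by ext; simp; ring }
  obtain ⟨G, hG⟩ := (AddSubmonoid.fg_eqLocusM f 0).map (h.comp (AddMonoidHom.fst _ _))
  refine ⟨G, fun z ↦ ?_⟩
  rw [hG, AddSubmonoid.mem_map]
  constructor
  · rintro ⟨x, hx, rfl⟩ q hq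
    have : q (h x.1) + x.2 ⟨q, hq⟩ = 0 := congrFun hx ⟨q, hq⟩
    have h0 : (0 : ℤ) ≤ x.2 ⟨q, hq⟩ := Int.natCast_nonneg _
    simp only [AddMonoidHom.comp_apply, AddMonoidHom.coe_fst]
    linarith
  · intro hz
    obtain ⟨x, rfl⟩ : z ∈ AddMonoidHom.mrange h := hh ▸ AddSubmonoid.mem_top z
    refine ⟨(x, fun q ↦ (-(q.1 (h x))).toNat), funext fun q ↦ ?_, rfl⟩
    have := hz q.1 q.2
    change q.1 (h x) + ((-(q.1 (h x))).toNat : ℤ) = 0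
    rw [Int.toNat_of_nonneg (by linarith)]
    ring

end Cone

/-! ### Passage from `V` to the cone over it in `V × ℝ` -/

section Homogenization

variable {M : Type*} [AddCommGroup M]

theorem extendFunctional_tmul (p : M →ₗ[ℤ] ℤ) (r : ℝ) (m : M) :
    extendFunctional p (r ⊗ₜ[ℤ] m) = p m * r := by
  simp [extendFunctional]

theorem extendFunctional_toAmbient (p : M →ₗ[ℤ] ℤ) (m : M) :
    extendFunctional p (toAmbient M m) = p m :=
  (extendFunctional_tmul p 1 m).trans (mul_one _)

/-- The embedding of `M × ℤ` as the integer points of `V × ℝ`. -/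
noncomputable def homogeneousEmbedding (M : Type*) [AddCommGroup M] :
    M × ℤ →+ Ambient M × ℝ :=
  (toAmbient M).toAddMonoidHom.prodMap (Int.castAddHom ℝ)

theorem homogeneousEmbedding_apply (z : M × ℤ) :
    homogeneousEmbedding M z = (toAmbient M z.1, (z.2 : ℝ)) := rfl

/-- The extension of integer functionals from `M × ℤ` to `V × ℝ`. -/
noncomputable def homogeneousExtension (M : Type*) [AddCommGroup M] :
    (M × ℤ →ₗ[ℤ] ℤ) →ₗ[ℤ] (Ambient M × ℝ →ₗ[ℝ] ℝ) where
  toFun q := (extendFunctional (q ∘ₗ LinearMap.inl ℤ M ℤ)).coprod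
    (LinearMap.toSpanSingleton ℝ ℝ (q (0, 1)))
  map_add' q q' := by
    ext <;> simp [extendFunctional_tmul]
  map_smul' a q := by
    ext <;> simp [extendFunctional_tmul]

theorem homogeneousExtension_apply (q : M × ℤ →ₗ[ℤ] ℤ) (w : Ambient M × ℝ) :
    homogeneousExtension M q w =
      extendFunctional (q ∘ₗ LinearMap.inl ℤ M ℤ) w.1 + w.2 * q (0, 1) := by
  simp [homogeneousExtension]

theorem homogeneousExtension_embedding (q : M × ℤ →ₗ[ℤ] ℤ) (z : M × ℤ) :
    homogeneousExtension M q (homogeneousEmbedding M z) = q z := by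
  obtain ⟨m, k⟩ := z
  have : q (m, k) = q (m, 0) + k * q (0, 1) := by
    rw [← smul_eq_mul, ← map_smul, ← map_add]
    simp
  rw [homogeneousExtension_apply, homogeneousEmbedding_apply, extendFunctional_toAmbient, this]
  simp

/-- Coordinates and their negatives suffice; this is the base case of the elimination. -/
theorem exists_finset_eq_zero [Module.Free ℤ M] [Module.Finite ℤ M] :
    ∃ Q : Finset (M × ℤ →ₗ[ℤ] ℤ), ∀ w : Ambient M × ℝ,
      (∀ q ∈ Q, homogeneousExtension M q w ≤ 0) → w = 0 := by
  classical
  let b := Module.Free.chooseBasis ℤ M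
  let A : Finset (M × ℤ →ₗ[ℤ] ℤ) := insert (LinearMap.snd ℤ M ℤ)
    (Finset.univ.image fun i ↦ b.coord i ∘ₗ LinearMap.fst ℤ M ℤ)
  refine ⟨A ∪ A.image (-·), fun w hw ↦ ?_⟩
  have hA : ∀ q ∈ A, homogeneousExtension M q w = 0 := by
    intro q hq
    have h := hw (-q) (Finset.mem_union_right _ (Finset.mem_image_of_mem _ hq))
    rw [map_neg, LinearMap.neg_apply] at h
    linarith [hw q (Finset.mem_union_left _ hq)]
  have hcoord (i) (v : Ambient M) :
      extendFunctional (b.coord i) v = (b.baseChange ℝ).repr v i := by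
    induction v using TensorProduct.induction_on with
    | zero => simp
    | tmul r m => simp [extendFunctional_tmul]
    | add x y hx hy => simp [hx, hy]
  refine Prod.ext ((b.baseChange ℝ).repr.map_eq_zero_iff.1 (Finsupp.ext fun i ↦ ?_)) ?_
  · have := hA _ (Finset.mem_insert_of_mem (Finset.mem_image_of_mem _ (Finset.mem_univ i)))
    rw [homogeneousExtension_apply, LinearMap.comp_assoc, LinearMap.fst_comp_inl,
      LinearMap.comp_id, hcoord] at this
    simpa using this
  · have := hA _ (Finset.mem_insert_self _ _)
    rw [homogeneousExtension_apply, LinearMap.snd_comp_inl] at this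
    simpa [extendFunctional] using this

theorem isRationalPolyhedron_slice (Q : Finset (M × ℤ →ₗ[ℤ] ℤ)) :
    IsRationalPolyhedron {v : Ambient M | ∀ q ∈ Q, homogeneousExtension M q (v, 1) ≤ 0} := by
  classical
  refine ⟨Q.image fun q ↦ (q ∘ₗ LinearMap.inl ℤ M ℤ, -q (0, 1)), ?_⟩
  ext v
  simp only [Set.mem_ofPred_eq, Finset.forall_mem_image, homogeneousExtension_apply]
  refine forall₂_congr fun q _ ↦ ?_
  push_cast
  rw [one_mul, ← le_neg_iff_add_nonpos_right]

theorem isIntegerSolutionSet_integerPoints {P : Set (Ambient M)} (hP : IsRationalPolyhedron P) :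
    IsIntegerSolutionSet (integerPoints P) := by
  obtain ⟨S, rfl⟩ := hP
  refine ⟨S, ?_⟩
  ext m
  simp only [integerPoints, Set.mem_ofPred_eq, extendFunctional_toAmbient, Int.cast_le]

theorem IsRationalPolyhedron.isPolyhedron {P : Set (Ambient M)} (hP : IsRationalPolyhedron P) :
    IsPolyhedron P := by
  classical
  obtain ⟨S, rfl⟩ := hP
  refine ⟨S.image fun s ↦ (extendFunctional s.1, (s.2 : ℝ)), ?_⟩
  ext v
  simp only [Set.mem_ofPred_eq, Finset.forall_mem_image]

end Homogenization

/-! ### Convex hulls of integer solution sets -/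

section Hull

variable {M : Type*} [AddCommGroup M] {X : Set M}

theorem toAmbient_mem_hull {m : M} (hm : m ∈ X) : toAmbient M m ∈ hull X :=
  subset_convexHull ℝ _ ⟨m, hm, rfl⟩

theorem convex_hull : Convex ℝ (hull X) := convex_convexHull ℝ _

theorem hull_subset {C : Set (Ambient M)} (hC : Convex ℝ C) (h : ∀ m ∈ X, toAmbient M m ∈ C) :
    hull X ⊆ C :=
  convexHull_min (by rintro _ ⟨m, hm, rfl⟩; exact h m hm) hC

/-- A nonempty face of the convex hull of a set of integer points contains one of them. -/
theorem integerPoints_face_nonempty {F : Set (Ambient M)} (hF : IsFace (hull X) F)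
    (hne : F.Nonempty) : (integerPoints F).Nonempty := by
  obtain ⟨p, rfl⟩ := hF
  obtain ⟨v, hv, hmax⟩ := hne
  by_contra hempty
  -- If no point of `X` attained the maximum, an open half-space missing `v` would contain the hull.
  have hlt : hull X ⊆ {w | p w < p v} := by
    refine hull_subset (convex_halfSpace_lt p.isLinear _) fun m hm ↦ ?_
    refine lt_of_le_of_ne (hmax _ (toAmbient_mem_hull hm)) fun h ↦ hempty ⟨m, ?_⟩
    exact ⟨toAmbient_mem_hull hm, fun w hw ↦ (hmax w hw).trans h.ge⟩
  exact lt_irrefl (p v) (hlt hv)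

/-- The convex hull of a set of integer points that is stable under addition of `r` is stable
under addition of nonnegative real multiples of `r`. -/
theorem add_smul_mem_hull {r : M} (hr : ∀ m ∈ X, m + r ∈ X) {y : Ambient M} (hy : y ∈ hull X)
    {c : ℝ} (hc : 0 ≤ c) : y + c • toAmbient M r ∈ hull X := by
  have h1 : hull X ⊆ (fun z ↦ z + toAmbient M r) ⁻¹' hull X := by
    refine hull_subset (convex_hull.translate_preimage_left _) fun m hm ↦ ?_
    rw [Set.mem_preimage, ← map_add]
    exact toAmbient_mem_hull (hr m hm)
  have h2 (n : ℕ) : y + (n : ℝ) • toAmbient M r ∈ hull X := by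
    induction n with
    | zero => simpa using hy
    | succ n ih =>
      have := h1 ih
      rw [Set.mem_preimage, add_assoc] at this
      rwa [Nat.cast_succ, add_smul, one_smul]
  obtain ⟨n, hn⟩ := exists_nat_gt c
  have hn0 : (0 : ℝ) < n := hc.trans_lt hn
  have := convex_hull.add_smul_mem hy (h2 n) (t := c / n)
    ⟨div_nonneg hc hn0.le, (div_le_one hn0).2 hn.le⟩
  rwa [smul_smul, div_mul_cancel₀ _ hn0.ne'] at this

/-- **Meyer's theorem**: the convex hull of the integer solutions of a finite system of linear
inequalities with integer coefficients is a rational polyhedron. -/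
theorem IsIntegerSolutionSet.isRationalPolyhedron_hull [Module.Free ℤ M] [Module.Finite ℤ M]
    (hX : IsIntegerSolutionSet X) : IsRationalPolyhedron (hull X) := by
  classical
  obtain ⟨S, rfl⟩ := hX
  set X := {m : M | ∀ s ∈ S, s.1 m ≤ s.2}
  obtain ⟨G, hG⟩ := exists_finset_closure_eq (insert (-LinearMap.snd ℤ M ℤ)
    (S.image fun s ↦ s.1 ∘ₗ LinearMap.fst ℤ M ℤ - s.2 • LinearMap.snd ℤ M ℤ))
  replace hG (z : M × ℤ) : z ∈ AddSubmonoid.closure (G : Set (M × ℤ)) ↔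
      0 ≤ z.2 ∧ ∀ s ∈ S, s.1 z.1 ≤ s.2 * z.2 := by
    rw [hG, Finset.forall_mem_insert, Finset.forall_mem_image]
    simp
  obtain ⟨Q, hQ⟩ := exists_finset_cone_iff homogeneousExtension_embedding
    (exists_finset_eq_zero (M := M)) {g ∈ G | g.2 ≤ 1}
  convert isRationalPolyhedron_slice Q using 1
  simp only [← hQ, homogeneousEmbedding_apply]
  refine Set.Subset.antisymm (hull_subset ?_ fun m hm ↦ ?_) ?_
  · rintro v ⟨c, hc, hv⟩ w ⟨d, hd, hw⟩ a b ha hb hab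
    refine ⟨fun g ↦ a * c g + b * d g, fun g hg ↦
      add_nonneg (mul_nonneg ha (hc g hg)) (mul_nonneg hb (hd g hg)), ?_⟩
    simp only [add_smul, mul_smul, Finset.sum_add_distrib, ← Finset.smul_sum, ← hv, ← hw]
    simp [hab]
  · have hmG : (m, (1 : ℤ)) ∈ AddSubmonoid.closure (G : Set (M × ℤ)) :=
      (hG _).2 ⟨zero_le_one, fun s hs ↦ by simpa using hm s hs⟩
    -- Heights are nonnegative, so summands of an element of height at most 1 again have height at
    -- most 1.
    have main : ∀ z ∈ AddSubmonoid.closure (G : Set (M × ℤ)), z.2 ≤ 1 →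
        ∃ c : M × ℤ → ℝ, (∀ g ∈ {g ∈ G | g.2 ≤ 1}, 0 ≤ c g) ∧
          homogeneousEmbedding M z = ∑ g ∈ {g ∈ G | g.2 ≤ 1}, c g • homogeneousEmbedding M g := by
      intro z hz
      induction hz using AddSubmonoid.closure_induction with
      | mem z hz =>
        intro h
        refine ⟨Pi.single z 1, fun g _ ↦ ?_, ?_⟩
        · by_cases h : g = z <;> simp [h]
        · have hz' : z ∈ ({g ∈ G | g.2 ≤ 1} : Finset (M × ℤ)) :=
            Finset.mem_filter.2 ⟨hz, h⟩
          rw [Finset.sum_eq_single_of_mem z hz' fun g _ hg ↦ by simp [hg]]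
          simp
      | zero => exact fun _ ↦ ⟨0, by simp, by simp⟩
      | add x y hx hy ihx ihy =>
        intro h
        have hx0 := ((hG x).1 hx).1
        have hy0 := ((hG y).1 hy).1
        rw [Prod.snd_add] at h
        obtain ⟨c, hc, hcx⟩ := ihx (by linarith)
        obtain ⟨d, hd, hdy⟩ := ihy (by linarith)
        refine ⟨c + d, fun g hg ↦ add_nonneg (hc g hg) (hd g hg), ?_⟩
        simp only [Pi.add_apply, add_smul, Finset.sum_add_distrib, map_add, hcx, hdy]
    obtain ⟨c, hc, h⟩ := main _ hmG le_rfl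
    refine ⟨c, hc, ?_⟩
    simpa [homogeneousEmbedding_apply] using h
  · rintro v ⟨c, hc, hv⟩
    have hgen : ∀ g ∈ ({g ∈ G | g.2 ≤ 1} : Finset (M × ℤ)),
        (0 ≤ g.2 ∧ ∀ s ∈ S, s.1 g.1 ≤ s.2 * g.2) ∧ g.2 ≤ 1 := fun g hg ↦
      ⟨(hG g).1 (AddSubmonoid.subset_closure (Finset.mem_filter.1 hg).1),
        (Finset.mem_filter.1 hg).2⟩
    set G' : Finset (M × ℤ) := {g ∈ G | g.2 ≤ 1}
    have hv1 : v = ∑ g ∈ G', c g • toAmbient M g.1 := by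
      simpa [Prod.fst_sum] using congrArg Prod.fst hv
    have hv2 : 1 = ∑ g ∈ G', c g * (g.2 : ℝ) := by
      simpa [Prod.snd_sum] using congrArg Prod.snd hv
    have hray : ∀ g ∈ G', g.2 ≠ 1 → g.2 = 0 := fun g hg h ↦ by
      have := hgen g hg
      lia
    -- Height-one generators give a convex combination of solutions; height-zero ones give recession
    -- directions.
    rw [← Finset.sum_filter_add_sum_filter_not G' (fun g ↦ g.2 = 1)] at hv1 hv2
    have hone : ∑ g ∈ G' with g.2 = 1, c g = 1 := by
      rw [hv2, Finset.sum_eq_zero (s := {g ∈ G' | ¬ g.2 = 1}), add_zero]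
      · refine Finset.sum_congr rfl fun g hg ↦ ?_
        simp [(Finset.mem_filter.1 hg).2]
      · intro g hg
        obtain ⟨hg, h⟩ := Finset.mem_filter.1 hg
        simp [hray g hg h]
    have hbase : ∑ g ∈ G' with g.2 = 1, c g • toAmbient M g.1 ∈ hull X := by
      refine convex_hull.sum_mem (fun g hg ↦ hc g (Finset.mem_filter.1 hg).1) hone
        fun g hg ↦ toAmbient_mem_hull fun s hs ↦ ?_
      obtain ⟨hg, h⟩ := Finset.mem_filter.1 hg
      simpa [h] using (hgen g hg).1.2 s hs
    rw [hv1]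
    have hsum (H : Finset (M × ℤ)) (hH : H ⊆ {g ∈ G' | ¬ g.2 = 1}) (y : Ambient M)
        (hy : y ∈ hull X) : y + ∑ g ∈ H, c g • toAmbient M g.1 ∈ hull X := by
      induction H using Finset.induction_on with
      | empty => simpa using hy
      | insert r H hr ih =>
        obtain ⟨hrG, hr1⟩ := Finset.mem_filter.1 (hH (Finset.mem_insert_self _ _))
        rw [Finset.sum_insert hr, add_left_comm, add_comm]
        refine add_smul_mem_hull (fun m hm s hs ↦ ?_)
          (ih ((Finset.subset_insert _ _).trans hH)) (hc r hrG)
        have h0 := (hgen r hrG).1.2 s hs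
        rw [hray r hrG hr1, mul_zero] at h0
        rw [map_add]
        linarith [hm s hs]
    exact hsum _ subset_rfl _ hbase

theorem integerPoints_hull_subset {C : Set (Ambient M)} (hC : Convex ℝ C)
    (h : X ⊆ integerPoints C) : integerPoints (hull X) ⊆ integerPoints C :=
  fun _ hm ↦ hull_subset hC h hm

theorem IsRationalPolyhedron.convex {P : Set (Ambient M)} (hP : IsRationalPolyhedron P) :
    Convex ℝ P := by
  obtain ⟨S, rfl⟩ := hP
  simp only [Set.ofPred_forall]
  exact convex_iInter₂ fun s _ ↦ convex_halfSpace_le (extendFunctional s.1).isLinear _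

theorem IsIntegerSolutionSet.eq_integerPoints_hull (hX : IsIntegerSolutionSet X) :
    X = integerPoints (hull X) := by
  refine Set.Subset.antisymm (fun m hm ↦ toAmbient_mem_hull hm) ?_
  obtain ⟨S, rfl⟩ := hX
  have hP : IsRationalPolyhedron {v : Ambient M | ∀ s ∈ S, extendFunctional s.1 v ≤ (s.2 : ℝ)} :=
    ⟨S, rfl⟩
  have heq : {m : M | ∀ s ∈ S, s.1 m ≤ s.2} =
      integerPoints {v : Ambient M | ∀ s ∈ S, extendFunctional s.1 v ≤ (s.2 : ℝ)} := by
    ext m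
    simp only [integerPoints, Set.mem_ofPred_eq, extendFunctional_toAmbient, Int.cast_le]
  have := integerPoints_hull_subset hP.convex heq.subset
  rwa [← heq] at this

end Hull

/-! ### Facets of a polyhedral hull have integer equations -/

section Facet

variable {M : Type*} [AddCommGroup M] {X : Set M}

/-- The points `(m, 1)` of `M × ℤ` with `m ∈ X`. -/
def homogenization (X : Set M) : Set (M × ℤ) := (fun m ↦ (m, 1)) '' X

theorem isIntegerSolutionSet_of_forall_mem_iff (Q : Finset (M × ℤ →ₗ[ℤ] ℤ))
    (h : ∀ m, m ∈ X ↔ ∀ q ∈ Q, q (m, 1) ≤ 0) : IsIntegerSolutionSet X := by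
  convert isIntegerSolutionSet_integerPoints (isRationalPolyhedron_slice Q) using 1
  ext m
  rw [h]
  refine forall₂_congr fun q _ ↦ ?_
  have := homogeneousExtension_embedding q (m, 1)
  rw [homogeneousEmbedding_apply, Int.cast_one] at this
  rw [this]
  exact Int.cast_nonpos.symm

/-- A point of the convex hull of `X` at which a linear functional attains its maximum `0` lies in
the span of the points of `X` with this property. -/
theorem mem_span_face {φ : Ambient M × ℝ →ₗ[ℝ] ℝ} (hφ : ∀ m ∈ X, φ (toAmbient M m, 1) ≤ 0)
    {v : Ambient M} (hv : v ∈ hull X) (hv0 : φ (v, 1) = 0) :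
    (v, (1 : ℝ)) ∈ Submodule.span ℝ (homogeneousEmbedding M ''
      {s ∈ homogenization X | φ (homogeneousEmbedding M s) = 0}) := by
  set F := Submodule.span ℝ (homogeneousEmbedding M ''
      {s ∈ homogenization X | φ (homogeneousEmbedding M s) = 0})
  -- This set is convex: if a sum of two nonpositive terms is zero, both are zero.
  have hsub : hull X ⊆ {v | φ (v, 1) ≤ 0 ∧ (φ (v, 1) = 0 → (v, (1 : ℝ)) ∈ F)} := by
    refine hull_subset ?_ fun m hm ↦ ⟨hφ m hm, fun h ↦ Submodule.subset_span ?_⟩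
    · rintro x ⟨hx, hx'⟩ y ⟨hy, hy'⟩ a b ha hb hab
      have hxy : (a • x + b • y, (1 : ℝ)) = a • (x, (1 : ℝ)) + b • (y, (1 : ℝ)) := by
        simp [hab]
      have hφxy : φ (a • x + b • y, (1 : ℝ)) = a * φ (x, 1) + b * φ (y, 1) := by
        rw [hxy, map_add, map_smul, map_smul, smul_eq_mul, smul_eq_mul]
      have hax := mul_nonpos_of_nonneg_of_nonpos ha hx
      have hby := mul_nonpos_of_nonneg_of_nonpos hb hy
      refine ⟨hφxy ▸ add_nonpos hax hby, fun h ↦ ?_⟩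
      rw [hφxy] at h
      have hmem {c : ℝ} {z : Ambient M} (hz : φ (z, 1) = 0 → (z, (1 : ℝ)) ∈ F)
          (hc : c * φ (z, 1) = 0) : c • (z, (1 : ℝ)) ∈ F := by
        rcases mul_eq_zero.1 hc with rfl | hc
        · rw [zero_smul]
          exact F.zero_mem
        · exact F.smul_mem _ (hz hc)
      rw [hxy]
      exact F.add_mem (hmem hx' (by linarith)) (hmem hy' (by linarith))
    · refine ⟨(m, 1), ⟨⟨m, hm, rfl⟩, ?_⟩, ?_⟩
      · rw [homogeneousEmbedding_apply, Int.cast_one]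
        exact h
      · rw [homogeneousEmbedding_apply, Int.cast_one]
  exact (hsub hv).2 hv0

/-- In an irredundant system of inequalities for the convex hull of `X`, each functional is
proportional to an integer functional on the span of `X`. -/
theorem exists_functional_of_irredundant [Module.Finite ℤ M] {ι : Type*} [DecidableEq ι]
    (φ : ι → Ambient M × ℝ →ₗ[ℝ] ℝ) (J : Finset ι)
    (hφ : ∀ j ∈ J, ∀ m ∈ X, φ j (toAmbient M m, 1) ≤ 0)
    (hJ : ∀ v : Ambient M, (v, (1 : ℝ)) ∈ Submodule.span ℝ
      (homogeneousEmbedding M '' homogenization X) → (∀ j ∈ J, φ j (v, 1) ≤ 0) → v ∈ hull X)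
    (hmin : ∀ i ∈ J, ∃ v : Ambient M, (v, (1 : ℝ)) ∈ Submodule.span ℝ
      (homogeneousEmbedding M '' homogenization X) ∧
      (∀ j ∈ J.erase i, φ j (v, 1) ≤ 0) ∧ 0 < φ i (v, 1)) {i : ι} (hi : i ∈ J) :
    ∃ (q : M × ℤ →ₗ[ℤ] ℤ) (c : ℝ), 0 < c ∧
      ∀ w ∈ Submodule.span ℝ (homogeneousEmbedding M '' homogenization X),
        φ i w = c * homogeneousExtension M q w := by
  set L := Submodule.span ℝ (homogeneousEmbedding M '' homogenization X) with hL
  have hXL : ∀ m ∈ X, (toAmbient M m, (1 : ℝ)) ∈ L := fun m hm ↦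
    Submodule.subset_span ⟨(m, 1), ⟨m, hm, rfl⟩, by
      rw [homogeneousEmbedding_apply, Int.cast_one]⟩
  have hneg : ∀ j ∈ J, ∃ m ∈ X, φ j (toAmbient M m, 1) < 0 := by
    intro j hj
    by_contra! h
    have hker : L ≤ LinearMap.ker (φ j) := by
      rw [hL, Submodule.span_le]
      rintro _ ⟨_, ⟨m, hm, rfl⟩, rfl⟩
      rw [homogeneousEmbedding_apply, Int.cast_one]
      exact le_antisymm (hφ j hj m hm) (h m hm)
    obtain ⟨v, hv, -, hpos⟩ := hmin j hj
    exact hpos.ne' (hker hv)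
  choose! x hxX hx using hneg
  have hcard : (0 : ℝ) < J.card := by exact_mod_cast Finset.card_pos.2 ⟨i, hi⟩
  -- The barycentre of the points `x j` satisfies every inequality strictly.
  obtain ⟨x₀, hx₀L, hx₀⟩ : ∃ v : Ambient M, (v, (1 : ℝ)) ∈ L ∧ ∀ j ∈ J, φ j (v, 1) < 0 := by
    have hsum : (∑ k ∈ J, (J.card : ℝ)⁻¹ • toAmbient M (x k), (1 : ℝ)) =
        ∑ k ∈ J, (J.card : ℝ)⁻¹ • (toAmbient M (x k), (1 : ℝ)) := by
      refine Prod.ext (by simp [Prod.fst_sum]) ?_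
      simp [Prod.snd_sum, hcard.ne']
    refine ⟨_, hsum ▸ L.sum_mem fun k hk ↦ L.smul_mem _ (hXL _ (hxX k hk)), fun j hj ↦ ?_⟩
    rw [hsum, map_sum]
    simp only [map_smul, smul_eq_mul]
    refine Finset.sum_neg' (fun k hk ↦ ?_) ⟨j, hj, ?_⟩
    · exact mul_nonpos_of_nonneg_of_nonpos (inv_pos.2 hcard).le (hφ j hj _ (hxX k hk))
    · exact mul_neg_of_pos_of_neg (inv_pos.2 hcard) (hx j hj)
  obtain ⟨w, hwL, hw, hwi⟩ := hmin i hi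
  -- The segment from `x₀` to `w`, which violates only inequality `i`, crosses its hyperplane at a
  -- relative interior point of the facet.
  obtain ⟨y, hyL, hyi, hy⟩ : ∃ y : Ambient M, (y, (1 : ℝ)) ∈ L ∧ φ i (y, 1) = 0 ∧
      ∀ j ∈ J.erase i, φ j (y, 1) < 0 := by
    set a := φ i (w, 1)
    set b := -φ i (x₀, 1) with hb
    have hb0 : 0 < b := neg_pos.2 (hx₀ i hi)
    have hab : 0 < a + b := add_pos hwi hb0
    have hy : ((a / (a + b)) • x₀ + (b / (a + b)) • w, (1 : ℝ)) =
        (a / (a + b)) • (x₀, (1 : ℝ)) + (b / (a + b)) • (w, (1 : ℝ)) := by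
      refine Prod.ext rfl ?_
      simp [← add_div, hab.ne']
    refine ⟨_, hy ▸ L.add_mem (L.smul_mem _ hx₀L) (L.smul_mem _ hwL), ?_, fun j hj ↦ ?_⟩
    · rw [hy, map_add, map_smul, map_smul, smul_eq_mul, smul_eq_mul,
        show φ i (x₀, 1) = -b by rw [hb, neg_neg]]
      change _ + b / (a + b) * a = 0
      ring
    · rw [hy, map_add, map_smul, map_smul, smul_eq_mul, smul_eq_mul]
      exact add_neg_of_neg_of_nonpos
        (mul_neg_of_pos_of_neg (div_pos hwi hab) (hx₀ j (Finset.mem_of_mem_erase hj)))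
        (mul_nonpos_of_nonneg_of_nonpos (div_pos hb0 hab).le (hw j hj))
  set F := Submodule.span ℝ (homogeneousEmbedding M ''
      {s ∈ homogenization X | φ i (homogeneousEmbedding M s) = 0})
  have hface {v : Ambient M} (hvL : (v, (1 : ℝ)) ∈ L) (hvi : φ i (v, 1) = 0)
      (hv : ∀ j ∈ J.erase i, φ j (v, 1) ≤ 0) : (v, (1 : ℝ)) ∈ F := by
    refine mem_span_face (hφ i hi) (hJ v hvL fun j hj ↦ ?_) hvi
    rcases eq_or_ne j i with rfl | hji
    · exact hvi.le
    · exact hv j (Finset.mem_erase.2 ⟨hji, hj⟩)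
  have hyF : (y, (1 : ℝ)) ∈ F := hface hyL hyi fun j hj ↦ (hy j hj).le
  -- A small move from `y` along the hyperplane within `L` stays in the facet, so the facet spans
  -- all such directions.
  have hdir (u : Ambient M) (huL : (u, (0 : ℝ)) ∈ L) (hui : φ i (u, 0) = 0) :
      (u, (0 : ℝ)) ∈ F := by
    obtain ⟨ε, hε, hε0⟩ : ∃ ε : ℝ,
        (∀ j ∈ J.erase i, φ j (y, 1) + ε * φ j (u, 0) < 0) ∧ 0 < ε := by
      have hev : ∀ᶠ ε : ℝ in nhdsWithin 0 (Set.Ioi 0),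
          ∀ j ∈ J.erase i, φ j (y, 1) + ε * φ j (u, 0) < 0 := by
        refine (Filter.eventually_all_finset _).2 fun j hj ↦ ?_
        have hcont : Filter.Tendsto (fun ε : ℝ ↦ φ j (y, 1) + ε * φ j (u, 0)) (nhds 0)
            (nhds (φ j (y, 1) + 0 * φ j (u, 0))) := by
          apply Continuous.tendsto (f := fun ε : ℝ ↦ φ j (y, 1) + ε * φ j (u, 0))
          fun_prop
        rw [zero_mul, add_zero] at hcont
        exact (hcont.eventually_lt_const (hy j hj)).filter_mono nhdsWithin_le_nhds
      exact (hev.and self_mem_nhdsWithin).exists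
    have heq : (y + ε • u, (1 : ℝ)) = (y, (1 : ℝ)) + ε • (u, (0 : ℝ)) := by
      refine Prod.ext rfl ?_
      simp
    have hval (j) : φ j (y + ε • u, 1) = φ j (y, 1) + ε * φ j (u, 0) := by
      rw [heq, map_add, map_smul, smul_eq_mul]
    have hmem : (y + ε • u, (1 : ℝ)) ∈ F := by
      refine hface ?_ ?_ fun j hj ↦ ?_
      · rw [heq]
        exact L.add_mem hyL (L.smul_mem _ huL)
      · rw [hval, hyi, hui, mul_zero, add_zero]
      · rw [hval]
        exact (hε j hj).le
    rw [heq] at hmem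
    exact (F.smul_mem_iff hε0.ne').1 ((F.add_mem_iff_right hyF).1 hmem)
  refine exists_functional_eq_mul homogeneousExtension_embedding (homogenization X) (φ i) ?_
    (z := (x i, 1)) ⟨x i, hxX i hi, rfl⟩ ?_
  · rintro ⟨v, t⟩ hv hvi
    have heq : (v, t) - t • (y, (1 : ℝ)) = (v - t • y, (0 : ℝ)) := by
      refine Prod.ext rfl ?_
      simp
    have := hdir (v - t • y) (heq ▸ L.sub_mem hv (L.smul_mem _ hyL)) (by
      rw [← heq, map_sub, map_smul, hvi, hyi, smul_zero, sub_zero])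
    rw [← heq] at this
    exact (F.sub_mem_iff_left (F.smul_mem _ hyF)).1 this
  · rw [homogeneousEmbedding_apply, Int.cast_one]
    exact hx i hi

theorem IsPseudoConvex.isIntegerSolutionSet [Module.Free ℤ M] [Module.Finite ℤ M]
    (hX : IsPseudoConvex X) : IsIntegerSolutionSet X := by
  classical
  obtain ⟨hX, S, hS⟩ := hX
  let φ : (Ambient M →ₗ[ℝ] ℝ) × ℝ → Ambient M × ℝ →ₗ[ℝ] ℝ := fun s ↦
    s.1 ∘ₗ LinearMap.fst ℝ (Ambient M) ℝ - s.2 • LinearMap.snd ℝ (Ambient M) ℝ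
  have hφ (s) (v : Ambient M) : φ s (v, 1) ≤ 0 ↔ s.1 v ≤ s.2 := by
    simp [φ]
  let L := Submodule.span ℝ (homogeneousEmbedding M '' homogenization X)
  let good : Finset ((Ambient M →ₗ[ℝ] ℝ) × ℝ) → Prop := fun J ↦
    ∀ v : Ambient M, (v, (1 : ℝ)) ∈ L → (∀ j ∈ J, φ j (v, 1) ≤ 0) → v ∈ hull X
  have hSgood : good S := fun v _ hv ↦ by
    rw [hS]
    exact fun s hs ↦ (hφ s v).1 (hv s hs)
  obtain ⟨J, hJS, hJ⟩ := exists_minimal_le_of_wellFoundedLT good S hSgood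
  have hJφ : ∀ j ∈ J, ∀ m ∈ X, φ j (toAmbient M m, 1) ≤ 0 := fun j hj m hm ↦ by
    have := toAmbient_mem_hull hm
    rw [hS] at this
    exact (hφ j _).2 (this j (hJS hj))
  have hmin : ∀ i ∈ J, ∃ v : Ambient M, (v, (1 : ℝ)) ∈ L ∧
      (∀ j ∈ J.erase i, φ j (v, 1) ≤ 0) ∧ 0 < φ i (v, 1) := by
    intro i hi
    by_contra! h
    have : good (J.erase i) := fun v hvL hv ↦ hJ.prop v hvL fun j hj ↦ by
      rcases eq_or_ne j i with rfl | hji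
      · exact h v hvL hv
      · exact hv j (Finset.mem_erase.2 ⟨hji, hj⟩)
    exact Finset.notMem_erase i J (hJ.le_of_le this (Finset.erase_subset _ _) hi)
  have hq : ∀ i ∈ J, ∃ (q : M × ℤ →ₗ[ℤ] ℤ) (c : ℝ), 0 < c ∧
      ∀ w ∈ L, φ i w = c * homogeneousExtension M q w := fun i hi ↦
    exists_functional_of_irredundant φ J hJφ hJ.prop hmin hi
  choose! q c hc hqc using hq
  obtain ⟨Q, hQ, hQL⟩ := exists_finset_mem_span (e := homogeneousEmbedding M) (homogenization X)
  have hlift (m : M) : homogeneousEmbedding M (m, 1) = (toAmbient M m, (1 : ℝ)) := by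
    rw [homogeneousEmbedding_apply, Int.cast_one]
  have hsign (m : M) (hm : (toAmbient M m, (1 : ℝ)) ∈ L) (j) (hj : j ∈ J) :
      φ j (toAmbient M m, 1) ≤ 0 ↔ q j (m, 1) ≤ 0 := by
    rw [hqc j hj _ hm, ← hlift, homogeneousExtension_embedding,
      ← Int.cast_nonpos (R := ℝ)]
    exact ⟨fun h ↦ nonpos_of_mul_nonpos_right h (hc j hj),
      mul_nonpos_of_nonneg_of_nonpos (hc j hj).le⟩
  -- `Q` and its negatives impose the equations of `L`; on `L` the `q j` have the signs of the `φ
  -- j`.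
  refine isIntegerSolutionSet_of_forall_mem_iff (Q ∪ Q.image (-·) ∪ J.image q) fun m ↦ ?_
  simp only [Finset.forall_mem_union, Finset.forall_mem_image]
  constructor
  · intro hm
    have hm' : (m, (1 : ℤ)) ∈ homogenization X := ⟨m, hm, rfl⟩
    refine ⟨⟨fun p hp ↦ (hQ p hp _ hm').le, fun p hp ↦ ?_⟩, fun j hj ↦ ?_⟩
    · simp [hQ p hp _ hm']
    · exact (hsign m (hlift m ▸ Submodule.subset_span ⟨_, hm', rfl⟩) j hj).1 (hJφ j hj m hm)
  · rintro ⟨⟨h1, h2⟩, h3⟩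
    have hmL : (toAmbient M m, (1 : ℝ)) ∈ L := by
      rw [← hlift]
      refine hQL _ fun p hp ↦ le_antisymm (h1 p hp) ?_
      simpa using h2 hp
    rw [hX]
    exact hJ.prop _ hmL fun j hj ↦ (hsign m hmL j hj).2 (h3 hj)

end Facet

end DiscreteConvexity

theorem proposition1 {M : Type*} [AddCommGroup M] [Module.Free ℤ M] [Module.Finite ℤ M]
    (X : Set M) :
    List.TFAE [
      DiscreteConvexity.IsPseudoConvex X,
      ∃ P : Set (DiscreteConvexity.Ambient M),
        DiscreteConvexity.IsIntegerPolyhedron P ∧ X = DiscreteConvexity.integerPoints P,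
      DiscreteConvexity.IsIntegerSolutionSet X] := by
  tfae_have 1 → 3 := fun h ↦ h.isIntegerSolutionSet
  tfae_have 3 → 1 := fun h ↦ ⟨h.eq_integerPoints_hull, h.isRationalPolyhedron_hull.isPolyhedron⟩
  tfae_have 3 → 2 := fun h ↦ ⟨DiscreteConvexity.hull X, ⟨h.isRationalPolyhedron_hull,
    fun _ hF hne ↦ DiscreteConvexity.integerPoints_face_nonempty hF hne⟩, h.eq_integerPoints_hull⟩
  tfae_have 2 → 3 := by
    rintro ⟨P, ⟨hP, -⟩, rfl⟩
    exact DiscreteConvexity.isIntegerSolutionSet_integerPoints hP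
  tfae_finish
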